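/- Let $(\Omega,\mathcal F,\mathbb P)$ be a complete probability space, $E$ a separable real Banach space with Borel $\sigma$-algebra $\mathcal B(E)$ and dual $E^*$, and let $p\in\{0\}\cup[1,\infty)$. $L^0(E)$ is the space of almost sure equivalence classes of $E$-valued random variables with the topology of convergence in probability, and $L^p(E)$, $p\ge 1$, is the Banach space of classes of $p$-integrable ones. $\operatorname{cl}$ denotes closure in $L^p(E)$ (or in $E$), $\operatorname{conv}$ the convex hull and $\overline{\operatorname{conv}}=\operatorname{cl}\operatorname{conv}$. A set $A\subseteq L^p(E)$ is *decomposable* if $1_B\xi+1_{B^c}\zeta\in A$ for all $\xi,\zeta\in A$, $B\in\mathcal F$; $\operatorname{dec}A$ is the smallest decomposable set containing $A$. For a multifunction $X:\Omega\to\mathcal P(E)$, $L^p(X)$ is the set of $\xi\in L^p(E)$ with $\xi(\omega)\in X(\omega)$ for almost every $\omega$ with $X(\omega)\neq\emptyset$, and $\overline{\operatorname{conv}}\,X$ is taken pointwise. A *closed random set* is here a multifunction $X$ with almost surely closed and nonempty values such that $\{\omega: X(\omega)\cap U\ne\emptyset\}\in\mathcal F$ for every open $U\subseteq E$. For $\emptyset\ne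 A\subseteq L^p(E)$, $F_A$ denotes a closed random set with $L^p(F_A)=\operatorname{cl}\operatorname{dec}A$; the statement includes that one exists, and holds for every such $F_A$. A set $A\subseteq L^p(E)$ is *$p$-Choquet decomposable* if it contains every $Y\in L^p(E)$ for which there is a transition probability kernel $K$ from $\Omega$ to $E$ such that, almost surely, $K(\omega)$ is a Dirac measure and $K(\omega,F_A(\omega))=1$, and such that for every $L\in E^*$, almost surely, $L$ is $K(\omega)$-integrable with $L(Y(\omega))=\int_E L(x)\,K(\omega,dx)$. $\operatorname{chd}_pA$ is the intersection of all $p$-Choquet decomposable sets containing $A$. A subset $A$ of a Banach space $V$ is a *Choquet set* if it contains every $y\in V$ for which there are a regular Borel probability measure $\mu$ on $V$ and a Borel set $B\subseteq A$ with $\mu(B)=1$ such that every $L\in V^*$ is $\mu$-integrable with $L(y)=\int_V L\,d\mu$. $\operatorname{ch}A$ is the intersection of all Choquet sets containing $A$. **Theorem.** (i) If $p\ge 1$, then $\operatorname{chd}_pA$ is a Choquet set for every nonempty convex $A\subseteq L^p(E)$. (ii) For every $p\in\{0\}\cup[1,\infty)$ and every nonempty $A\subseteq L^p(E)$, a set $F_A$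 as above exists and, for each such $F_A$, $$\operatorname{chd}_p\operatorname{conv}A=L^p(\overline{\operatorname{conv}}\,F_A)=\overline{\operatorname{conv}}\,L^p(F_A)=\overline{\operatorname{conv}}\,\operatorname{chd}_pA=\operatorname{cl}\operatorname{conv}\operatorname{dec}A=\operatorname{cl}\operatorname{dec}\operatorname{conv}A,$$ and if $p\ge1$, then also $\operatorname{chd}_p\operatorname{ch}A=\operatorname{chd}_p\operatorname{conv}A$. -/

import Mathlib

open MeasureTheory ProbabilityTheory Filter Topology Set
open scoped ENNReal

namespace ChoquetDec

section Banach

variable {V : Type*} [NormedAddCommGroup V] [NormedSpace ℝ V]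

/-- `y` is the barycenter of the Borel measure `μ` on `V`: every continuous linear functional `L`
is `μ`-integrable and `L y = ∫ L dμ`. -/
def IsBarycenter [MeasurableSpace V] (μ : Measure V) (y : V) : Prop :=
  ∀ L : StrongDual ℝ V, Integrable (fun x => L x) μ ∧ L y = ∫ x, L x ∂μ

/-- `A` is a Choquet set: it contains the barycenter of each regular Borel probability measure
that has a barycenter and is concentrated on a Borel subset of `A`. -/
def IsChoquet (A : Set V) : Prop :=
  letI : MeasurableSpace V := borel V
  ∀ μ : Measure V, IsProbabilityMeasure μ → μ.Regular →
    (∃ B : Set V, B ⊆ A ∧ MeasurableSet B ∧ μ B = 1) →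
    ∀ y : V, IsBarycenter μ y → y ∈ A

/-- The Choquet hull: the intersection of all Choquet sets containing `A`. -/
def choquetHull (A : Set V) : Set V :=
  ⋂₀ {C | IsChoquet C ∧ A ⊆ C}

/-- The pointwise closed convex hull of a multifunction. -/
def cconvPointwise {Ω : Type*} (X : Ω → Set V) : Ω → Set V :=
  fun ω => closure (convexHull ℝ (X ω))

end Banach

section Lp

variable {Ω : Type*} [MeasurableSpace Ω] {P : Measure Ω}
  {E : Type*} [NormedAddCommGroup E] {p : ℝ≥0∞}

/-- The closure of `A` in `L^p`: limits of sequences in `A`, in the norm of `L^p` when `p ≠ 0` and in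
probability when `p = 0`. (`Lp E 0 P` is the space of all classes of random variables in `E`.) Both
topologies are metrizable, so sequences suffice; see `clp_eq_closure` for `1 ≤ p`. -/
def clp (A : Set (Lp E p P)) : Set (Lp E p P) :=
  {f | ∃ u : ℕ → Lp E p P, (∀ n, u n ∈ A) ∧
    (p = 0 → TendstoInMeasure P (fun n => (u n : Ω → E)) atTop (f : Ω → E)) ∧
    (p ≠ 0 → Tendsto (fun n => eLpNorm ((u n : Ω → E) - (f : Ω → E)) p P) atTop (𝓝 0))}

theorem clp_eq_closure [Fact (1 ≤ p)] (A : Set (Lp E p P)) : clp A = closure A := by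
  have hp : p ≠ 0 := (lt_of_lt_of_le one_pos (Fact.out : 1 ≤ p)).ne'
  ext f
  rw [mem_closure_iff_seq_limit]
  constructor
  · rintro ⟨u, hu, -, h⟩
    exact ⟨u, hu, (Lp.tendsto_Lp_iff_tendsto_eLpNorm' u f).2 (h hp)⟩
  · rintro ⟨u, hu, h⟩
    exact ⟨u, hu, fun h0 => absurd h0 hp,
      fun _ => (Lp.tendsto_Lp_iff_tendsto_eLpNorm' u f).1 h⟩

/-- `A` is decomposable: `1_B ξ + 1_{Bᶜ} ζ ∈ A` for all `ξ, ζ ∈ A` and all events `B`. -/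
def IsDecomposable (A : Set (Lp E p P)) : Prop :=
  ∀ ξ ∈ A, ∀ ζ ∈ A, ∀ B : Set Ω, MeasurableSet B → ∀ η : Lp E p P,
    (η : Ω → E) =ᵐ[P] B.indicator (ξ : Ω → E) + Bᶜ.indicator (ζ : Ω → E) → η ∈ A

/-- The decomposable hull: the intersection of all decomposable sets containing `A`. -/
def dec (A : Set (Lp E p P)) : Set (Lp E p P) :=
  ⋂₀ {C | IsDecomposable C ∧ A ⊆ C}

/-- The `p`-integrable selections `L^p(X)` of a multifunction `X`. -/
def selections (p : ℝ≥0∞) (P : Measure Ω) (X : Ω → Set E) : Set (Lp E p P) :=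
  {ξ | ∀ᵐ ω ∂P, (X ω).Nonempty → (ξ : Ω → E) ω ∈ X ω}

/-- An almost surely nonempty closed random set: a multifunction with almost surely nonempty closed
values which is Effros measurable. -/
structure IsClosedRandomSet (P : Measure Ω) (X : Ω → Set E) : Prop where
  nonempty : ∀ᵐ ω ∂P, (X ω).Nonempty
  isClosed : ∀ᵐ ω ∂P, IsClosed (X ω)
  effros : ∀ U : Set E, IsOpen U → MeasurableSet {ω | (X ω ∩ U).Nonempty}

/-- `F` is (a version of) the closed random set `F_A` attached to `A`: `L^p(F) = cl_p (dec A)`. -/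
def IsRepresentingSet (A : Set (Lp E p P)) (F : Ω → Set E) : Prop :=
  IsClosedRandomSet P F ∧ selections p P F = clp (dec A)

variable [NormedSpace ℝ E] [MeasurableSpace E]

/-- `Y` is the barycenter of the transition kernel `K`: for every `L` in the dual of `E`, almost surely,
`L` is `K ω`-integrable and `L (Y ω) = ∫ L(x) K(ω, dx)`. -/
def IsKernelBarycenter (K : Kernel Ω E) (Y : Lp E p P) : Prop :=
  ∀ L : StrongDual ℝ E, ∀ᵐ ω ∂P,
    Integrable (fun x => L x) (K ω) ∧ L ((Y : Ω → E) ω) = ∫ x, L x ∂(K ω)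

/-- `A` is `p`-Choquet decomposable: it contains the barycenter in `L^p` of each transition probability
kernel `K` such that, almost surely, `K ω` is a Dirac measure and `K ω (F_A ω) = 1`. -/
def IsChoquetDecomposable (A : Set (Lp E p P)) : Prop :=
  ∀ F : Ω → Set E, IsRepresentingSet A F → ∀ K : Kernel Ω E, IsMarkovKernel K →
    (∀ᵐ ω ∂P, K ω (F ω) = 1) → (∀ᵐ ω ∂P, ∃ x : E, K ω = Measure.dirac x) →
    ∀ Y : Lp E p P, IsKernelBarycenter K Y → Y ∈ A

/-- The `p`-Choquet decomposable hull: the intersection of all `p`-Choquet decomposable sets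
containing `A`. -/
def chd (A : Set (Lp E p P)) : Set (Lp E p P) :=
  ⋂₀ {C | IsChoquetDecomposable C ∧ A ⊆ C}

/-- The closed convex hull in `L^p`. -/
def cconv (A : Set (Lp E p P)) : Set (Lp E p P) :=
  clp (convexHull ℝ A)

end Lp

end ChoquetDec

open ChoquetDec

/-! Everything reduces to `chd A = clp (dec A)` (`chd_eq_clp_dec`). A kernel that is almost surely
Dirac has only its own atom as barycenter, because functionals separate points of the separable
space `E`. Its barycenters carried by `F_C` are thus selections of `F_C`, and `C` is Choquet
decomposable exactly when it contains `clp (dec C)`.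

Hulls then commute formally. Gluing is linear in the pair of glued classes, so `dec` and
`convexHull` commute, and gluing and convex combinations are pointwise nonexpansive, so they pass to
`clp`. Hahn-Banach makes closed convex sets Choquet and two-point measures make Choquet sets convex;
hence the Choquet hull lies between the convex hull and its closure, and `chd` cannot tell them
apart.

The analytic content is the dictionary between decomposable sets and random sets. A decomposable set
has a countable subfamily whose pointwise closure captures every member, and any class in that
pointwise closure is a limit of finite gluings. This gives `F_A`. Applied to the convex hull of
`selections p P F`, with measurable selections to pass from classes to points of `F ω`, it gives
`selections_cconvPointwise`. -/

namespace ChoquetDec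

/-! ### One functional for norm convergence and convergence in probability. -/

section Modulus

variable {Ω : Type*} [MeasurableSpace Ω] {P : Measure Ω}
  {E : Type*} [NormedAddCommGroup E] {p : ℝ≥0∞}

/-- A functional metrizing `L^p`: the `L^p`-norm for `p ≠ 0` and the Ky Fan type functional
`∫ min(‖f‖, 1)` for `p = 0`. -/
noncomputable def modulus (p : ℝ≥0∞) (P : Measure Ω) (f : Ω → E) : ℝ≥0∞ :=
  open Classical in if p = 0 then ∫⁻ ω, min ‖f ω‖ₑ 1 ∂P else eLpNorm f p P

theorem modulus_zero (f : Ω → E) : modulus 0 P f = ∫⁻ ω, min ‖f ω‖ₑ 1 ∂P := if_pos rfl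

theorem modulus_of_ne_zero (hp : p ≠ 0) (f : Ω → E) : modulus p P f = eLpNorm f p P := if_neg hp

theorem modulus_mono {G : Type*} [NormedAddCommGroup G] {f : Ω → E} {g : Ω → G}
    (h : ∀ᵐ ω ∂P, ‖f ω‖ ≤ ‖g ω‖) : modulus p P f ≤ modulus p P g := by
  by_cases hp : p = 0
  · subst hp
    rw [modulus_zero, modulus_zero]
    refine lintegral_mono_ae ?_
    filter_upwards [h] with ω hω
    exact min_le_min_right _ (enorm_le_iff_norm_le.2 hω)
  · rw [modulus_of_ne_zero hp, modulus_of_ne_zero hp]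
    exact eLpNorm_mono_ae h

theorem modulus_add_le (hp : p = 0 ∨ 1 ≤ p) {f g : Ω → E} (hf : AEStronglyMeasurable f P)
    (hg : AEStronglyMeasurable g P) :
    modulus p P (fun ω => f ω + g ω) ≤ modulus p P f + modulus p P g := by
  rcases hp with rfl | hp
  · simp only [modulus_zero]
    rw [← lintegral_add_left' (hf.enorm.min aemeasurable_const)]
    refine lintegral_mono fun ω => ?_
    refine (min_le_min_right _ (enorm_add_le _ _)).trans ?_
    rcases le_total 1 ‖f ω‖ₑ with h1 | h1
    · exact (min_le_right _ _).trans ((min_eq_right h1).ge.trans le_self_add)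
    rcases le_total 1 ‖g ω‖ₑ with h2 | h2
    · exact (min_le_right _ _).trans ((min_eq_right h2).ge.trans le_add_self)
    · rw [min_eq_left h1, min_eq_left h2]
      exact min_le_left _ _
  · have h0 : p ≠ 0 := (one_pos.trans_le hp).ne'
    simp only [modulus_of_ne_zero h0]
    exact eLpNorm_add_le hf hg hp

theorem modulus_const_le [IsProbabilityMeasure P] (c : E) :
    modulus p P (fun _ => c) ≤ ‖c‖ₑ := by
  by_cases hp : p = 0
  · subst hp
    rw [modulus_zero]
    simp
  · rw [modulus_of_ne_zero hp, eLpNorm_const _ hp (IsProbabilityMeasure.ne_zero P)]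
    simp

theorem tendsto_modulus_indicator (hp' : p ≠ ∞) [IsFiniteMeasure P] {f : Ω → E}
    (hf : MemLp f p P) {S : ℕ → Set Ω} (hS : ∀ n, MeasurableSet (S n))
    (h : ∀ᵐ ω ∂P, ∀ᶠ n in atTop, ω ∉ S n) :
    Tendsto (fun n => modulus p P ((S n).indicator f)) atTop (𝓝 0) := by
  have hmeas : ∀ n, AEStronglyMeasurable ((S n).indicator f) P :=
    fun n => hf.aestronglyMeasurable.indicator (hS n)
  by_cases hp : p = 0
  · subst hp
    simp only [modulus_zero]
    have := tendsto_lintegral_of_dominated_convergence' (μ := P)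
      (F := fun n ω => min ‖(S n).indicator f ω‖ₑ 1) (f := fun _ => 0) (fun _ => 1)
      (fun n => (hmeas n).enorm.min aemeasurable_const)
      (fun n => Eventually.of_forall fun ω => min_le_right _ _) (by simp) ?_
    · simpa using this
    · filter_upwards [h] with ω hω
      refine tendsto_const_nhds.congr' ?_
      filter_upwards [hω] with n hn
      simp [indicator_of_notMem hn]
  · simp only [modulus_of_ne_zero hp, eLpNorm_eq_lintegral_rpow_enorm_toReal hp hp']
    have hpos : 0 < p.toReal := ENNReal.toReal_pos hp hp'
    have := tendsto_lintegral_of_dominated_convergence' (μ := P)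
      (F := fun n ω => ‖(S n).indicator f ω‖ₑ ^ p.toReal) (f := fun _ => 0)
      (fun ω => ‖f ω‖ₑ ^ p.toReal)
      (fun n => (hmeas n).enorm.pow_const _)
      (fun n => Eventually.of_forall fun ω =>
        ENNReal.rpow_le_rpow (enorm_indicator_le_enorm_self _ _) hpos.le)
      (lintegral_rpow_enorm_lt_top_of_eLpNorm_lt_top hp hp' hf.2).ne ?_
    · simp only [lintegral_zero] at this
      have h2 := (ENNReal.continuous_rpow_const (y := 1 / p.toReal)).tendsto 0 |>.comp this
      rw [ENNReal.zero_rpow_of_pos (by positivity)] at h2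
      exact h2
    · filter_upwards [h] with ω hω
      refine tendsto_const_nhds.congr' ?_
      filter_upwards [hω] with n hn
      simp [indicator_of_notMem hn, hpos]

/-- One direction splits the integral at a small level `δ`; the other is Markov's inequality at
level `min ε 1`. -/
theorem tendstoInMeasure_iff_tendsto_modulus [IsFiniteMeasure P] {u : ℕ → Ω → E} {f : Ω → E}
    (hu : ∀ n, AEStronglyMeasurable (u n) P) (hf : AEStronglyMeasurable f P) :
    TendstoInMeasure P u atTop f ↔ Tendsto (fun n => modulus 0 P (u n - f)) atTop (𝓝 0) := by
  have hm : ∀ n, AEMeasurable (fun ω => min ‖u n ω - f ω‖ₑ 1) P :=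
    fun n => ((hu n).sub hf).enorm.min aemeasurable_const
  simp only [modulus_zero, Pi.sub_apply]
  rw [tendstoInMeasure_iff_enorm]
  constructor
  · intro h
    rw [ENNReal.tendsto_nhds_zero]
    intro ε hε
    obtain ⟨δ, hδ, hδt, hδε⟩ : ∃ δ : ℝ≥0∞, 0 < δ ∧ δ ≠ ∞ ∧ δ * P univ + δ ≤ ε := by
      have hc : Tendsto (fun δ : ℝ≥0∞ => δ * P univ + δ) (𝓝[>] 0) (𝓝 (0 * P univ + 0)) := by
        refine Tendsto.mono_left (Tendsto.add ?_ tendsto_id) nhdsWithin_le_nhds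
        exact ENNReal.Tendsto.mul_const tendsto_id (Or.inr (measure_ne_top _ _))
      simp only [zero_mul, add_zero] at hc
      have := ((hc.eventually (Iic_mem_nhds hε)).and self_mem_nhdsWithin).and
        (mem_nhdsWithin_of_mem_nhds (Iio_mem_nhds (ENNReal.zero_lt_top : (0 : ℝ≥0∞) < ∞)))
      obtain ⟨δ, ⟨h1, h2⟩, h3⟩ := this.exists
      exact ⟨δ, h2, ne_of_lt h3, h1⟩
    filter_upwards [(ENNReal.tendsto_nhds_zero.1 (h δ hδ hδt)) δ hδ] with n hn
    refine le_trans ?_ hδε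
    have hms : NullMeasurableSet {ω | δ ≤ ‖u n ω - f ω‖ₑ} P :=
      nullMeasurableSet_le aemeasurable_const ((hu n).sub hf).enorm
    calc ∫⁻ ω, min ‖u n ω - f ω‖ₑ 1 ∂P
        ≤ ∫⁻ ω, δ + {ω | δ ≤ ‖u n ω - f ω‖ₑ}.indicator (fun _ => 1) ω ∂P := by
          refine lintegral_mono fun ω => ?_
          by_cases hω : δ ≤ ‖u n ω - f ω‖ₑ
          · rw [indicator_of_mem (by exact hω)]
            exact (min_le_right _ _).trans le_add_self
          · exact (min_le_left _ _).trans ((not_le.1 hω).le.trans le_self_add)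
      _ = δ * P univ + P {ω | δ ≤ ‖u n ω - f ω‖ₑ} := by
          rw [lintegral_add_left measurable_const, lintegral_const,
            lintegral_indicator_const₀ hms, one_mul]
      _ ≤ _ := by gcongr
  · intro h ε hε _
    have hδ : 0 < min ε 1 := lt_min hε one_pos
    have hδ' : min ε 1 ≠ ∞ := ((min_le_right _ _).trans_lt ENNReal.one_lt_top).ne
    have h2 : Tendsto (fun n => (min ε 1)⁻¹ * ∫⁻ ω, min ‖u n ω - f ω‖ₑ 1 ∂P) atTop (𝓝 0) := by
      have := ENNReal.Tendsto.const_mul (a := (min ε 1)⁻¹) h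
        (Or.inr (ENNReal.inv_ne_top.2 hδ.ne'))
      rwa [mul_zero] at this
    refine tendsto_of_tendsto_of_tendsto_of_le_of_le tendsto_const_nhds h2
      (fun _ => zero_le) fun n => ?_
    have h3 := mul_meas_ge_le_lintegral₀ (hm n) (min ε 1)
    rw [mul_comm, ← div_eq_mul_inv, ENNReal.le_div_iff_mul_le (Or.inl hδ.ne') (Or.inl hδ'), mul_comm]
    refine le_trans ?_ h3
    refine mul_le_mul' le_rfl (measure_mono fun ω hω => ?_)
    rw [mem_ofPred_eq] at hω ⊢
    exact min_le_min_right 1 hω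

theorem mem_clp_iff [IsFiniteMeasure P] {A : Set (Lp E p P)} {f : Lp E p P} :
    f ∈ clp A ↔ ∀ ε : ℝ≥0∞, 0 < ε → ∃ u ∈ A, modulus p P ((u : Ω → E) - (f : Ω → E)) ≤ ε := by
  have key : ∀ u : ℕ → Lp E p P,
      ((p = 0 → TendstoInMeasure P (fun n => (u n : Ω → E)) atTop (f : Ω → E)) ∧
      (p ≠ 0 → Tendsto (fun n => eLpNorm ((u n : Ω → E) - (f : Ω → E)) p P) atTop (𝓝 0))) ↔
      Tendsto (fun n => modulus p P ((u n : Ω → E) - (f : Ω → E))) atTop (𝓝 0) := by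
    intro u
    by_cases hp : p = 0
    · subst hp
      rw [← tendstoInMeasure_iff_tendsto_modulus (fun n => Lp.aestronglyMeasurable _)
        (Lp.aestronglyMeasurable _)]
      simp
    · simp [hp, modulus_of_ne_zero hp]
  simp only [clp, mem_ofPred_eq, key]
  constructor
  · rintro ⟨u, hu, h⟩ ε hε
    obtain ⟨n, hn⟩ := (ENNReal.tendsto_nhds_zero.1 h ε hε).exists
    exact ⟨u n, hu n, hn⟩
  · intro h
    have hpos : ∀ n : ℕ, (0 : ℝ≥0∞) < ((n : ℝ≥0∞))⁻¹ := fun n => by simp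
    choose u hu hle using fun n : ℕ => h ((n : ℝ≥0∞))⁻¹ (hpos n)
    exact ⟨u, hu, tendsto_of_tendsto_of_tendsto_of_le_of_le tendsto_const_nhds
      ENNReal.tendsto_inv_nat_nhds_zero (fun _ => zero_le) hle⟩

theorem exists_seq_tendsto_ae_of_mem_clp {A : Set (Lp E p P)} {f : Lp E p P}
    (hf : f ∈ clp A) : ∃ u : ℕ → Lp E p P, (∀ n, u n ∈ A) ∧
      ∀ᵐ ω ∂P, Tendsto (fun n => (u n : Ω → E) ω) atTop (𝓝 ((f : Ω → E) ω)) := by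
  obtain ⟨u, hu, h0, h1⟩ := hf
  have h : TendstoInMeasure P (fun n => (u n : Ω → E)) atTop (f : Ω → E) := by
    by_cases hp : p = 0
    · exact h0 hp
    · exact tendstoInMeasure_of_tendsto_eLpNorm hp (fun n => Lp.aestronglyMeasurable _)
        (Lp.aestronglyMeasurable _) (h1 hp)
  obtain ⟨φ, -, hφ⟩ := h.exists_seq_tendsto_ae
  exact ⟨fun n => u (φ n), fun n => hu _, hφ⟩

end Modulus

end ChoquetDec

namespace ChoquetDec

/-! ### Gluing, closure and convexity. -/

section Decomposable

variable {Ω : Type*} [MeasurableSpace Ω] {P : Measure Ω}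
  {E : Type*} [NormedAddCommGroup E] {p : ℝ≥0∞}

/-- The class that agrees with `ξ` on `B` and with `ζ` off `B`. -/
noncomputable def glue {B : Set Ω} (hB : MeasurableSet B) (ξ ζ : Lp E p P) : Lp E p P :=
  (((Lp.memLp ξ).indicator hB).add ((Lp.memLp ζ).indicator hB.compl)).toLp

theorem coeFn_glue {B : Set Ω} (hB : MeasurableSet B) (ξ ζ : Lp E p P) :
    (glue hB ξ ζ : Ω → E) =ᵐ[P] B.indicator (ξ : Ω → E) + Bᶜ.indicator (ζ : Ω → E) :=
  MemLp.coeFn_toLp _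

theorem glue_ae {B : Set Ω} (hB : MeasurableSet B) (ξ ζ : Lp E p P) :
    ∀ᵐ ω ∂P, (ω ∈ B → (glue hB ξ ζ : Ω → E) ω = (ξ : Ω → E) ω) ∧
      (ω ∉ B → (glue hB ξ ζ : Ω → E) ω = (ζ : Ω → E) ω) := by
  filter_upwards [coeFn_glue hB ξ ζ] with ω hω
  rw [hω]
  constructor <;> intro h <;> simp [h]

theorem glue_self {B : Set Ω} (hB : MeasurableSet B) (ξ : Lp E p P) : glue hB ξ ξ = ξ := by
  apply Lp.ext
  filter_upwards [glue_ae hB ξ ξ] with ω hω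
  by_cases h : ω ∈ B
  · exact hω.1 h
  · exact hω.2 h

theorem isDecomposable_iff {A : Set (Lp E p P)} :
    IsDecomposable A ↔
      ∀ (B : Set Ω) (hB : MeasurableSet B), ∀ ξ ∈ A, ∀ ζ ∈ A, glue hB ξ ζ ∈ A := by
  constructor
  · intro h B hB ξ hξ ζ hζ
    exact h ξ hξ ζ hζ B hB _ (coeFn_glue hB ξ ζ)
  · intro h ξ hξ ζ hζ B hB η hη
    have : η = glue hB ξ ζ := Lp.ext (hη.trans (coeFn_glue hB ξ ζ).symm)
    exact this ▸ h B hB ξ hξ ζ hζ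

theorem subset_dec (A : Set (Lp E p P)) : A ⊆ dec A := fun _ hx _ hC => hC.2 hx

theorem isDecomposable_dec (A : Set (Lp E p P)) : IsDecomposable (dec A) :=
  fun ξ hξ ζ hζ B hB η hη C hC => hC.1 ξ (hξ C hC) ζ (hζ C hC) B hB η hη

theorem dec_subset {A C : Set (Lp E p P)} (hC : IsDecomposable C) (h : A ⊆ C) : dec A ⊆ C :=
  fun _ hx => hx C ⟨hC, h⟩

theorem dec_mono {A C : Set (Lp E p P)} (h : A ⊆ C) : dec A ⊆ dec C :=
  dec_subset (isDecomposable_dec C) (h.trans (subset_dec C))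

theorem IsDecomposable.dec_eq {A : Set (Lp E p P)} (h : IsDecomposable A) : dec A = A :=
  (dec_subset h Subset.rfl).antisymm (subset_dec A)

theorem subset_clp (A : Set (Lp E p P)) : A ⊆ clp A := fun f hf =>
  ⟨fun _ => f, fun _ => hf, fun _ ε hε => by simp [hε.not_ge], fun _ => by simp⟩

theorem clp_mono {A C : Set (Lp E p P)} (h : A ⊆ C) : clp A ⊆ clp C :=
  fun _ ⟨u, hu, hlim⟩ => ⟨u, fun n => h (hu n), hlim⟩

theorem modulus_triangle (hp : p = 0 ∨ 1 ≤ p) (f g h : Lp E p P) :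
    modulus p P ((f : Ω → E) - (h : Ω → E)) ≤
      modulus p P ((f : Ω → E) - (g : Ω → E)) + modulus p P ((g : Ω → E) - (h : Ω → E)) := by
  refine le_trans (le_of_eq ?_) (modulus_add_le hp
    ((Lp.aestronglyMeasurable f).sub (Lp.aestronglyMeasurable g))
    ((Lp.aestronglyMeasurable g).sub (Lp.aestronglyMeasurable h)))
  congr 1
  ext ω
  simp

theorem clp_clp [IsFiniteMeasure P] (hp : p = 0 ∨ 1 ≤ p) (A : Set (Lp E p P)) :
    clp (clp A) = clp A := by
  refine Subset.antisymm (fun f hf => ?_) (subset_clp _)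
  rw [mem_clp_iff] at hf ⊢
  intro ε hε
  obtain ⟨g, hg, hgf⟩ := hf (ε / 2) (ENNReal.half_pos hε.ne')
  obtain ⟨u, hu, hug⟩ := mem_clp_iff.1 hg (ε / 2) (ENNReal.half_pos hε.ne')
  refine ⟨u, hu, (modulus_triangle hp u g f).trans ?_⟩
  exact (add_le_add hug hgf).trans (ENNReal.add_halves ε).le

theorem clp_subset {A C : Set (Lp E p P)}
    (hC : clp C = C) (h : A ⊆ C) : clp A ⊆ C := (clp_mono h).trans hC.subset

/-- The closure is stable under binary operations that are pointwise nonexpansive. -/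
theorem map_mem_clp [IsFiniteMeasure P] (hp : p = 0 ∨ 1 ≤ p) {A : Set (Lp E p P)}
    (Φ : Lp E p P → Lp E p P → Lp E p P)
    (hΦ : ∀ ξ ζ ξ' ζ' : Lp E p P, ∀ᵐ ω ∂P, ‖(Φ ξ ζ : Ω → E) ω - (Φ ξ' ζ' : Ω → E) ω‖ ≤
      ‖(ξ : Ω → E) ω - (ξ' : Ω → E) ω‖ + ‖(ζ : Ω → E) ω - (ζ' : Ω → E) ω‖)
    (hA : ∀ ξ ∈ A, ∀ ζ ∈ A, Φ ξ ζ ∈ A) {ξ ζ : Lp E p P} (hξ : ξ ∈ clp A) (hζ : ζ ∈ clp A) :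
    Φ ξ ζ ∈ clp A := by
  rw [mem_clp_iff] at *
  intro ε hε
  obtain ⟨u, hu, hu'⟩ := hξ (ε / 2) (ENNReal.half_pos hε.ne')
  obtain ⟨v, hv, hv'⟩ := hζ (ε / 2) (ENNReal.half_pos hε.ne')
  refine ⟨Φ u v, hA u hu v hv, ?_⟩
  have h1 : ∀ a b : Lp E p P,
      AEStronglyMeasurable (fun ω => ‖(a : Ω → E) ω - (b : Ω → E) ω‖) P :=
    fun a b => ((Lp.aestronglyMeasurable a).sub (Lp.aestronglyMeasurable b)).norm
  calc modulus p P ((Φ u v : Ω → E) - (Φ ξ ζ : Ω → E))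
      ≤ modulus p P (fun ω => ‖(u : Ω → E) ω - (ξ : Ω → E) ω‖ +
          ‖(v : Ω → E) ω - (ζ : Ω → E) ω‖) := by
        refine modulus_mono ?_
        filter_upwards [hΦ u v ξ ζ] with ω hω
        rw [Real.norm_of_nonneg (by positivity)]
        exact hω
    _ ≤ modulus p P (fun ω => ‖(u : Ω → E) ω - (ξ : Ω → E) ω‖) +
          modulus p P (fun ω => ‖(v : Ω → E) ω - (ζ : Ω → E) ω‖) :=
        modulus_add_le hp (h1 u ξ) (h1 v ζ)
    _ ≤ ε / 2 + ε / 2 := by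
        refine add_le_add (le_trans ?_ hu') (le_trans ?_ hv') <;>
        exact modulus_mono (Eventually.of_forall fun ω => by simp)
    _ = ε := ENNReal.add_halves ε

theorem isDecomposable_clp [IsFiniteMeasure P] (hp : p = 0 ∨ 1 ≤ p) {A : Set (Lp E p P)}
    (hA : IsDecomposable A) : IsDecomposable (clp A) := by
  rw [isDecomposable_iff] at *
  intro B hB ξ hξ ζ hζ
  refine map_mem_clp hp (glue hB) (fun a b a' b' => ?_) (hA B hB) hξ hζ
  filter_upwards [glue_ae hB a b, glue_ae hB a' b'] with ω h1 h2
  by_cases hω : ω ∈ B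
  · rw [h1.1 hω, h2.1 hω]
    exact le_add_of_nonneg_right (norm_nonneg _)
  · rw [h1.2 hω, h2.2 hω]
    exact le_add_of_nonneg_left (norm_nonneg _)

variable [NormedSpace ℝ E]

theorem convex_clp [IsFiniteMeasure P] (hp : p = 0 ∨ 1 ≤ p) {A : Set (Lp E p P)}
    (hA : Convex ℝ A) : Convex ℝ (clp A) := by
  intro ξ hξ ζ hζ a b ha hb hab
  refine map_mem_clp hp (fun x y => a • x + b • y) (fun x y x' y' => ?_)
    (fun x hx y hy => hA hx hy ha hb hab) hξ hζ
  filter_upwards [Lp.coeFn_add (a • x) (b • y), Lp.coeFn_add (a • x') (b • y'),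
    Lp.coeFn_smul a x, Lp.coeFn_smul b y, Lp.coeFn_smul a x', Lp.coeFn_smul b y']
    with ω h1 h2 h3 h4 h5 h6
  simp only [h1, h2, h3, h4, h5, h6, Pi.add_apply, Pi.smul_apply]
  have : a • (x : Ω → E) ω + b • (y : Ω → E) ω - (a • (x' : Ω → E) ω + b • (y' : Ω → E) ω) =
      a • ((x : Ω → E) ω - (x' : Ω → E) ω) + b • ((y : Ω → E) ω - (y' : Ω → E) ω) := by
    module
  rw [this]
  refine (norm_add_le _ _).trans (add_le_add ?_ ?_)
  · rw [norm_smul, Real.norm_of_nonneg ha]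
    exact mul_le_of_le_one_left (norm_nonneg _) (by linarith)
  · rw [norm_smul, Real.norm_of_nonneg hb]
    exact mul_le_of_le_one_left (norm_nonneg _) (by linarith)

theorem glue_combo {B : Set Ω} (hB : MeasurableSet B) (a b : ℝ) (x y x' y' : Lp E p P) :
    glue hB (a • x + b • y) (a • x' + b • y') = a • glue hB x x' + b • glue hB y y' := by
  apply Lp.ext
  filter_upwards [glue_ae hB (a • x + b • y) (a • x' + b • y'), glue_ae hB x x', glue_ae hB y y',
    Lp.coeFn_add (a • x) (b • y), Lp.coeFn_add (a • x') (b • y'),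
    Lp.coeFn_add (a • glue hB x x') (b • glue hB y y'),
    Lp.coeFn_smul a x, Lp.coeFn_smul b y, Lp.coeFn_smul a x', Lp.coeFn_smul b y',
    Lp.coeFn_smul a (glue hB x x'), Lp.coeFn_smul b (glue hB y y')]
    with ω h1 h2 h3 h4 h5 h6 h7 h8 h9 h10 h11 h12
  simp only [h6, h11, h12, Pi.add_apply, Pi.smul_apply]
  by_cases hω : ω ∈ B
  · rw [h1.1 hω, h2.1 hω, h3.1 hω, h4, Pi.add_apply, h7, h8, Pi.smul_apply, Pi.smul_apply]
  · rw [h1.2 hω, h2.2 hω, h3.2 hω, h5, Pi.add_apply, h9, h10, Pi.smul_apply, Pi.smul_apply]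

theorem isDecomposable_convexHull {A : Set (Lp E p P)} (hA : IsDecomposable A) :
    IsDecomposable (convexHull ℝ A) := by
  rw [isDecomposable_iff] at *
  intro B hB ξ hξ ζ hζ
  -- Working with pairs avoids finding common weights for `ξ` and `ζ`: gluing is linear on the
  -- product, and the hull of a product is the product of the hulls.
  have h : convexHull ℝ (A ×ˢ A) ⊆ {z | glue hB z.1 z.2 ∈ convexHull ℝ A} := by
    refine convexHull_min (fun z hz => subset_convexHull ℝ A (hA B hB _ hz.1 _ hz.2)) ?_
    intro z hz w hw a b ha hb hab
    have := convex_convexHull ℝ A hz hw ha hb hab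
    rwa [← glue_combo] at this
  rw [convexHull_prod] at h
  exact h (mk_mem_prod hξ hζ)

theorem convex_dec {A : Set (Lp E p P)} (hA : Convex ℝ A) : Convex ℝ (dec A) := by
  intro x hx y hy a b ha hb hab
  -- Hull induction in one variable at a time: `y` is first frozen in `A`, then `x` in `dec A`. By
  -- `glue_self`, gluing does not affect the frozen variable.
  have h1 : ∀ y ∈ A, dec A ⊆ {x | a • x + b • y ∈ dec A} := by
    intro y hy
    refine dec_subset (isDecomposable_iff.2 fun B hB ξ hξ ζ hζ => ?_)
      (fun x hx => subset_dec A (hA hx hy ha hb hab))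
    have := isDecomposable_iff.1 (isDecomposable_dec A) B hB _ hξ _ hζ
    rwa [glue_combo, glue_self] at this
  have h2 : dec A ⊆ {y | a • x + b • y ∈ dec A} := by
    refine dec_subset (isDecomposable_iff.2 fun B hB ξ hξ ζ hζ => ?_) (fun y hy => h1 y hy hx)
    have := isDecomposable_iff.1 (isDecomposable_dec A) B hB _ hξ _ hζ
    rwa [glue_combo, glue_self] at this
  exact h2 hy

theorem dec_convexHull (A : Set (Lp E p P)) : dec (convexHull ℝ A) = convexHull ℝ (dec A) :=
  (dec_subset (isDecomposable_convexHull (isDecomposable_dec A))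
    (convexHull_mono (subset_dec A))).antisymm
  (convexHull_min (dec_mono (subset_convexHull ℝ A)) (convex_dec (convex_convexHull ℝ A)))

end Decomposable

end ChoquetDec

namespace ChoquetDec

/-! ### Countable dense families in decomposable sets. -/

section Castaing

variable {Ω : Type*} [MeasurableSpace Ω] {P : Measure Ω}
  {E : Type*} [NormedAddCommGroup E] {p : ℝ≥0∞}

/-- A countable subfamily of a decomposable set comes as close to a given point as every member
of the set. -/
theorem exists_seq_iInf_enorm_sub_le [IsFiniteMeasure P] {C : Set (Lp E p P)} (hne : C.Nonempty)
    (hC : IsDecomposable C) (e : E) :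
    ∃ ξ : ℕ → Lp E p P, (∀ n, ξ n ∈ C) ∧ ∀ ζ ∈ C, ∀ᵐ ω ∂P,
      ⨅ n, min ‖(ξ n : Ω → E) ω - e‖ₑ 1 ≤ min ‖(ζ : Ω → E) ω - e‖ₑ 1 := by
  set φ : Lp E p P → Ω → ℝ≥0∞ := fun ξ ω => min ‖(ξ : Ω → E) ω - e‖ₑ 1
  have hφm : ∀ ξ, Measurable (φ ξ) := fun ξ =>
    ((Lp.stronglyMeasurable ξ).sub stronglyMeasurable_const).enorm.min measurable_const
  set α : ℝ≥0∞ := ⨅ ξ ∈ C, ∫⁻ ω, φ ξ ω ∂P with hα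
  have hαt : α ≠ ∞ := by
    obtain ⟨ξ, hξ⟩ := hne
    refine ne_top_of_le_ne_top ?_ (iInf₂_le ξ hξ)
    refine ne_top_of_le_ne_top (b := ∫⁻ _, 1 ∂P) (by simp)
      (lintegral_mono fun ω => min_le_right _ _)
  -- A minimizing sequence for the mean truncated distance to `e`; at `n = 0` the slack is `∞`,
  -- which is harmless.
  have hex : ∀ n : ℕ, ∃ ξ ∈ C, ∫⁻ ω, φ ξ ω ∂P < α + (n : ℝ≥0∞)⁻¹ := by
    intro n
    have h : α < α + (n : ℝ≥0∞)⁻¹ := ENNReal.lt_add_right hαt (by simp)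
    nth_rewrite 1 [hα] at h
    simpa [iInf_lt_iff] using h
  choose ξ hξC hξ using hex
  refine ⟨ξ, hξC, fun ζ hζ => ?_⟩
  -- Switching from `ξ n` to `ζ` where `ζ` is nearer to `e` stays in `C`, so it cannot push the
  -- integral below `α`; the total gain is at most the slack of `ξ n`.
  have hle : ∀ n, ∫⁻ ω, (φ (ξ n) ω - φ ζ ω) ∂P ≤ (n : ℝ≥0∞)⁻¹ := by
    intro n
    have hB : MeasurableSet {ω | φ ζ ω < φ (ξ n) ω} := measurableSet_lt (hφm ζ) (hφm (ξ n))
    have hg := isDecomposable_iff.1 hC _ hB ζ hζ (ξ n) (hξC n)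
    have h1 : α ≤ ∫⁻ ω, min (φ (ξ n) ω) (φ ζ ω) ∂P := by
      refine (iInf₂_le _ hg).trans (lintegral_mono_ae ?_)
      filter_upwards [glue_ae hB ζ (ξ n)] with ω hω
      by_cases h : φ ζ ω < φ (ξ n) ω
      · rw [min_eq_right h.le]
        exact (congrArg (fun z => min ‖z - e‖ₑ 1) (hω.1 h)).le
      · rw [min_eq_left (not_lt.1 h)]
        exact (congrArg (fun z => min ‖z - e‖ₑ 1) (hω.2 h)).le
    have h2 : ∫⁻ ω, φ (ξ n) ω ∂P =
        ∫⁻ ω, (φ (ξ n) ω - φ ζ ω) ∂P + ∫⁻ ω, min (φ (ξ n) ω) (φ ζ ω) ∂P := by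
      rw [← lintegral_add_left (f := fun ω => φ (ξ n) ω - φ ζ ω) ((hφm (ξ n)).sub (hφm ζ))]
      simp only [tsub_add_min]
    have h3 := (add_le_add_right h1 _).trans (h2 ▸ (hξ n).le)
    rw [add_comm] at h3
    exact (ENNReal.add_le_add_iff_left hαt).1 h3
  have hzero : ∫⁻ ω, ((⨅ n, φ (ξ n) ω) - φ ζ ω) ∂P = 0 := by
    refine le_antisymm (ge_of_tendsto' ENNReal.tendsto_inv_nat_nhds_zero fun n => ?_) zero_le
    exact (lintegral_mono fun ω => tsub_le_tsub_right (iInf_le _ n) _).trans (hle n)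
  rw [lintegral_eq_zero_iff (f := fun ω => (⨅ n, φ (ξ n) ω) - φ ζ ω)
    ((Measurable.iInf fun n => hφm (ξ n)).sub (hφm ζ))] at hzero
  filter_upwards [hzero] with ω hω
  exact tsub_eq_zero_iff_le.1 hω

theorem exists_seq_ae_mem_closure [TopologicalSpace.SeparableSpace E] [IsFiniteMeasure P]
    {C : Set (Lp E p P)} (hne : C.Nonempty) (hC : IsDecomposable C) :
    ∃ ξ : ℕ → Lp E p P, (∀ n, ξ n ∈ C) ∧ ∀ ζ ∈ C, ∀ᵐ ω ∂P,
      (ζ : Ω → E) ω ∈ closure (range fun n => (ξ n : Ω → E) ω) := by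
  choose ξ hξC hξ using fun i : ℕ =>
    exists_seq_iInf_enorm_sub_le hne hC (TopologicalSpace.denseSeq E i)
  refine ⟨fun k => ξ k.unpair.1 k.unpair.2, fun k => hξC _ _, fun ζ hζ => ?_⟩
  filter_upwards [ae_all_iff.2 fun i => hξ i ζ hζ] with ω hω
  rw [Metric.mem_closure_range_iff]
  intro ε hε
  -- The radius is capped at 1 so that the truncation of the distances at 1 has no effect.
  obtain ⟨i, hi⟩ := (TopologicalSpace.denseRange_denseSeq E).exists_dist_lt ((ζ : Ω → E) ω)
    (show 0 < min (ε / 2) 1 by positivity)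
  have hδ : 0 < min (ε / 2) 1 := by positivity
  have h1 : ‖(ζ : Ω → E) ω - TopologicalSpace.denseSeq E i‖ₑ < ENNReal.ofReal (min (ε / 2) 1) := by
    rw [← ofReal_norm, ENNReal.ofReal_lt_ofReal_iff hδ, ← dist_eq_norm]
    exact hi
  have h2 := (hω i).trans_lt ((min_le_left _ _).trans_lt h1)
  obtain ⟨n, hn⟩ := iInf_lt_iff.1 h2
  have h3 : ‖(ξ i n : Ω → E) ω - TopologicalSpace.denseSeq E i‖ₑ <
      ENNReal.ofReal (min (ε / 2) 1) := by
    rcases min_lt_iff.1 hn with h | h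
    · exact h
    · refine absurd h (not_lt.2 ?_)
      rw [ENNReal.ofReal_le_one]
      exact min_le_right _ _
  rw [← ofReal_norm, ENNReal.ofReal_lt_ofReal_iff hδ, ← dist_eq_norm] at h3
  refine ⟨Nat.pair i n, ?_⟩
  simp only [Nat.unpair_pair]
  calc dist ((ζ : Ω → E) ω) ((ξ i n : Ω → E) ω)
      ≤ _ := dist_triangle_right _ _ (TopologicalSpace.denseSeq E i)
    _ < min (ε / 2) 1 + min (ε / 2) 1 := add_lt_add hi h3
    _ ≤ ε / 2 + ε / 2 := add_le_add (min_le_left _ _) (min_le_left _ _)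
    _ = ε := add_halves ε

/-- Almost every `ω` has some `η k` within `δ` of `Y`. Gluing finitely many of them gives a member
of `C` within `δ` of `Y` off a set that shrinks to a null set, where `η 0` is kept. The error there
vanishes by dominated convergence, hence `p ≠ ∞`. -/
theorem mem_clp_of_ae_mem_closure [IsProbabilityMeasure P] (hp : p = 0 ∨ 1 ≤ p) (hp' : p ≠ ∞)
    {C : Set (Lp E p P)} (hC : IsDecomposable C) {η : ℕ → Lp E p P} (hη : ∀ n, η n ∈ C)
    {Y : Lp E p P}
    (hY : ∀ᵐ ω ∂P, (Y : Ω → E) ω ∈ closure (range fun n => (η n : Ω → E) ω)) : Y ∈ clp C := by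
  rw [mem_clp_iff]
  intro ε hε
  obtain ⟨δ, hδ, hδε⟩ : ∃ δ : ℝ, 0 < δ ∧ ‖δ‖ₑ ≤ ε / 2 := by
    have h2 : (0 : ℝ≥0∞) < ε / 2 := ENNReal.half_pos hε.ne'
    obtain ⟨r, hr, hr'⟩ := ENNReal.lt_iff_exists_nnreal_btwn.1 h2
    refine ⟨r, by exact_mod_cast hr, ?_⟩
    simpa using hr'.le
  set B : ℕ → Set Ω := fun k => {ω | ‖(η k : Ω → E) ω - (Y : Ω → E) ω‖ < δ} with hBdef
  have hB : ∀ k, MeasurableSet (B k) := fun k => measurableSet_lt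
    ((Lp.stronglyMeasurable (η k)).sub (Lp.stronglyMeasurable Y)).norm.measurable measurable_const
  have hg : ∀ N : ℕ, ∃ g ∈ C, ∀ᵐ ω ∂P,
      ((∃ k < N, ω ∈ B k) → ‖(g : Ω → E) ω - (Y : Ω → E) ω‖ < δ) ∧
      ((¬∃ k < N, ω ∈ B k) → (g : Ω → E) ω = (η 0 : Ω → E) ω) := by
    intro N
    induction N with
    | zero => exact ⟨η 0, hη 0, Eventually.of_forall fun ω => by simp⟩
    | succ N ih =>
      obtain ⟨g, hgC, hg⟩ := ih
      refine ⟨glue (hB N) (η N) g, isDecomposable_iff.1 hC _ (hB N) _ (hη N) _ hgC, ?_⟩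
      filter_upwards [hg, glue_ae (hB N) (η N) g] with ω h1 h2
      by_cases hω : ω ∈ B N
      · rw [h2.1 hω]
        exact ⟨fun _ => hω, fun h => absurd ⟨N, N.lt_succ_self, hω⟩ h⟩
      · rw [h2.2 hω]
        have : (∃ k < N + 1, ω ∈ B k) ↔ ∃ k < N, ω ∈ B k := by
          refine ⟨fun ⟨k, hk, hk'⟩ => ⟨k, ?_, hk'⟩, fun ⟨k, hk, hk'⟩ => ⟨k, by omega, hk'⟩⟩
          refine lt_of_le_of_ne (by omega) ?_
          rintro rfl
          exact hω hk'
        rwa [this]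
  set S : ℕ → Set Ω := fun N => (⋃ k ∈ Finset.range N, B k)ᶜ with hSdef
  have hS : ∀ N, MeasurableSet (S N) := fun N =>
    (Finset.measurableSet_biUnion _ fun k _ => hB k).compl
  have hSmem : ∀ N ω, ω ∈ S N ↔ ¬∃ k < N, ω ∈ B k := fun N ω => by simp [hSdef]
  have hlim := tendsto_modulus_indicator hp' (Lp.memLp (η 0 - Y)) hS (by
    filter_upwards [hY] with ω hω
    obtain ⟨k, hk⟩ := Metric.mem_closure_range_iff.1 hω δ hδ
    filter_upwards [eventually_gt_atTop k] with N hN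
    rw [hSmem, not_not]
    refine ⟨k, hN, ?_⟩
    rw [dist_comm, dist_eq_norm] at hk
    exact hk)
  obtain ⟨N, hN⟩ := (ENNReal.tendsto_nhds_zero.1 hlim (ε / 2) (ENNReal.half_pos hε.ne')).exists
  obtain ⟨g, hgC, hg⟩ := hg N
  refine ⟨g, hgC, ?_⟩
  calc modulus p P ((g : Ω → E) - (Y : Ω → E))
      ≤ modulus p P (fun ω => δ + ‖(S N).indicator ((η 0 - Y : Lp E p P) : Ω → E) ω‖) := by
        refine modulus_mono ?_
        filter_upwards [hg, Lp.coeFn_sub (η 0) Y] with ω h1 h2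
        rw [Real.norm_of_nonneg (by positivity), Pi.sub_apply]
        by_cases hω : ∃ k < N, ω ∈ B k
        · exact (h1.1 hω).le.trans (le_add_of_nonneg_right (norm_nonneg _))
        · rw [h1.2 hω, indicator_of_mem ((hSmem N ω).2 hω), h2, Pi.sub_apply]
          exact le_add_of_nonneg_left hδ.le
    _ ≤ modulus p P (fun _ : Ω => δ) +
          modulus p P (fun ω => ‖(S N).indicator ((η 0 - Y : Lp E p P) : Ω → E) ω‖) :=
        modulus_add_le hp aestronglyMeasurable_const
          ((Lp.aestronglyMeasurable _).indicator (hS N)).norm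
    _ ≤ ε / 2 + ε / 2 :=
        add_le_add ((modulus_const_le δ).trans hδε)
          ((modulus_mono (Eventually.of_forall fun ω => by simp)).trans hN)
    _ = ε := ENNReal.add_halves ε

theorem clp_subset_selections {A : Set (Lp E p P)} {X : Ω → Set E}
    (hX : ∀ᵐ ω ∂P, (X ω).Nonempty ∧ IsClosed (X ω)) (h : A ⊆ selections p P X) :
    clp A ⊆ selections p P X := by
  intro f hf
  obtain ⟨u, hu, hlim⟩ := exists_seq_tendsto_ae_of_mem_clp hf
  show ∀ᵐ ω ∂P, _
  have hu' : ∀ᵐ ω ∂P, ∀ n, (X ω).Nonempty → (u n : Ω → E) ω ∈ X ω :=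
    ae_all_iff.2 fun n => h (hu n)
  filter_upwards [hX, hlim, hu'] with ω h1 h2 h3 _
  exact h1.2.mem_of_tendsto h2 (Eventually.of_forall fun n => h3 n h1.1)

theorem mem_selections_iff {X : Ω → Set E} (hX : ∀ᵐ ω ∂P, (X ω).Nonempty) {ξ : Lp E p P} :
    ξ ∈ selections p P X ↔ ∀ᵐ ω ∂P, (ξ : Ω → E) ω ∈ X ω := by
  constructor
  · intro h
    filter_upwards [hX, (h : ∀ᵐ ω ∂P, _)] with ω h1 h2 using h2 h1
  · intro h
    exact h.mono fun ω hω _ => hω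

theorem isDecomposable_selections (X : Ω → Set E) : IsDecomposable (selections p P X) := by
  rw [isDecomposable_iff]
  intro B hB ξ hξ ζ hζ
  show ∀ᵐ ω ∂P, _
  filter_upwards [(hξ : ∀ᵐ ω ∂P, _), (hζ : ∀ᵐ ω ∂P, _), glue_ae hB ξ ζ] with ω h1 h2 h3 hne
  by_cases hω : ω ∈ B
  · rw [h3.1 hω]
    exact h1 hne
  · rw [h3.2 hω]
    exact h2 hne

theorem selections_closure_range_eq_clp [IsProbabilityMeasure P] (hp : p = 0 ∨ 1 ≤ p)
    (hp' : p ≠ ∞) {C : Set (Lp E p P)} (hC : IsDecomposable C) {ξ : ℕ → Lp E p P}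
    (hξ : ∀ n, ξ n ∈ C) (hdense : ∀ ζ ∈ C, ∀ᵐ ω ∂P,
      (ζ : Ω → E) ω ∈ closure (range fun n => (ξ n : Ω → E) ω)) :
    selections p P (fun ω => closure (range fun n => (ξ n : Ω → E) ω)) = clp C := by
  have hne : ∀ᵐ ω ∂P, (closure (range fun n => (ξ n : Ω → E) ω)).Nonempty :=
    Eventually.of_forall fun ω => (range_nonempty _).closure
  refine Subset.antisymm (fun Y hY => ?_) (clp_subset_selections ?_ fun ζ hζ => ?_)
  · exact mem_clp_of_ae_mem_closure hp hp' hC hξ ((mem_selections_iff hne).1 hY)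
  · exact hne.mono fun ω hω => ⟨hω, isClosed_closure⟩
  · exact (mem_selections_iff hne).2 (hdense ζ hζ)

theorem isClosedRandomSet_closure_range [MeasurableSpace E] [BorelSpace E] (ξ : ℕ → Lp E p P) :
    IsClosedRandomSet P (fun ω => closure (range fun n => (ξ n : Ω → E) ω)) where
  nonempty := Eventually.of_forall fun ω => (range_nonempty _).closure
  isClosed := Eventually.of_forall fun ω => isClosed_closure
  effros U hU := by
    have : {ω | (closure (range fun n => (ξ n : Ω → E) ω) ∩ U).Nonempty} =
        ⋃ n, (ξ n : Ω → E) ⁻¹' U := by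
      ext ω
      rw [mem_ofPred_eq, closure_inter_open_nonempty_iff hU]
      simp [Set.Nonempty]
    rw [this]
    exact MeasurableSet.iUnion fun n =>
      (Lp.stronglyMeasurable (ξ n)).measurable hU.measurableSet

theorem exists_isRepresentingSet [TopologicalSpace.SeparableSpace E] [IsProbabilityMeasure P]
    (hp : p = 0 ∨ 1 ≤ p) (hp' : p ≠ ∞) {A : Set (Lp E p P)} (hA : A.Nonempty) :
    ∃ F : Ω → Set E, IsRepresentingSet A F := by
  borelize E
  obtain ⟨ξ, hξ, hdense⟩ :=
    exists_seq_ae_mem_closure (hA.mono (subset_dec A)) (isDecomposable_dec A)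
  exact ⟨_, isClosedRandomSet_closure_range ξ,
    selections_closure_range_eq_clp hp hp' (isDecomposable_dec A) hξ hdense⟩

end Castaing

end ChoquetDec

namespace ChoquetDec

/-! ### Measurable selections and the pointwise closed convex hull. -/

section Selection

variable {Ω : Type*} [MeasurableSpace Ω] {P : Measure Ω}
  {E : Type*} [NormedAddCommGroup E] {p : ℝ≥0∞}

/-- One halving step of the selection scheme: the least index whose half-radius ball meets `X ω`
inside the old ball. -/
theorem exists_refined_index [TopologicalSpace.SeparableSpace E] {X : Ω → Set E}
    (hX : ∀ U : Set E, IsOpen U → MeasurableSet {ω | (X ω ∩ U).Nonempty})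
    {n : Ω → ℕ} (hn : Measurable n) {ρ : ℝ} (hρ : 0 < ρ) :
    ∃ m : Ω → ℕ, Measurable m ∧ ∀ ω,
      dist (TopologicalSpace.denseSeq E (n ω)) (TopologicalSpace.denseSeq E (m ω)) ≤ 2 * ρ ∧
      ((X ω ∩ Metric.ball (TopologicalSpace.denseSeq E (n ω)) ρ).Nonempty →
        (X ω ∩ Metric.ball (TopologicalSpace.denseSeq E (m ω)) (ρ / 2)).Nonempty) := by
  classical
  set D := TopologicalSpace.denseSeq E
  -- The second alternative keeps the old index when its ball misses `X ω`, so that `Nat.find` is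
  -- defined everywhere.
  let q : Ω → ℕ → Prop := fun ω m =>
    (X ω ∩ (Metric.ball (D (n ω)) ρ ∩ Metric.ball (D m) (ρ / 2))).Nonempty ∨
      (¬(X ω ∩ Metric.ball (D (n ω)) ρ).Nonempty ∧ m = n ω)
  have hq : ∀ ω, ∃ m, q ω m := by
    intro ω
    by_cases h : (X ω ∩ Metric.ball (D (n ω)) ρ).Nonempty
    · obtain ⟨x, hx, hx'⟩ := h
      obtain ⟨m, hm⟩ :=
        (TopologicalSpace.denseRange_denseSeq E).exists_dist_lt x (half_pos hρ)
      exact ⟨m, Or.inl ⟨x, hx, hx', hm⟩⟩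
    · exact ⟨n ω, Or.inr ⟨h, rfl⟩⟩
  have hmeas : ∀ S : ℕ → Set Ω, (∀ j, MeasurableSet (S j)) → MeasurableSet {ω | ω ∈ S (n ω)} := by
    intro S hS
    have : {ω | ω ∈ S (n ω)} = ⋃ j, n ⁻¹' {j} ∩ S j := by
      ext ω
      simp
    rw [this]
    exact MeasurableSet.iUnion fun j => (hn (measurableSet_singleton j)).inter (hS j)
  have hqm : ∀ m, MeasurableSet {ω | q ω m} := by
    intro m
    refine MeasurableSet.union (hmeas
      (fun j => {ω | (X ω ∩ (Metric.ball (D j) ρ ∩ Metric.ball (D m) (ρ / 2))).Nonempty})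
      fun j => hX _ (Metric.isOpen_ball.inter Metric.isOpen_ball)) (MeasurableSet.inter ?_ ?_)
    · exact (hmeas (fun j => {ω | (X ω ∩ Metric.ball (D j) ρ).Nonempty})
        fun j => hX _ Metric.isOpen_ball).compl
    · exact measurableSet_eq_fun measurable_const hn
  refine ⟨fun ω => Nat.find (hq ω), measurable_find hq hqm, fun ω => ?_⟩
  rcases Nat.find_spec (hq ω) with ⟨x, hx, hx1, hx2⟩ | ⟨h, heq⟩
  · refine ⟨?_, fun _ => ⟨x, hx, hx2⟩⟩
    rw [Metric.mem_ball] at hx1 hx2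
    have := dist_triangle_left (D (n ω)) (D (Nat.find (hq ω))) x
    linarith
  · refine ⟨?_, fun h' => absurd h' h⟩
    show dist (D (n ω)) (D (Nat.find (hq ω))) ≤ 2 * ρ
    rw [heq, dist_self]
    positivity

/-- Measurable selections of a closed random set localized near a given point
(after Kuratowski and Ryll-Nardzewski). -/
theorem exists_measurable_selection_near [TopologicalSpace.SeparableSpace E] [CompleteSpace E]
    [MeasurableSpace E] [BorelSpace E] {X : Ω → Set E}
    (hX : ∀ U : Set E, IsOpen U → MeasurableSet {ω | (X ω ∩ U).Nonempty})
    (i : ℕ) {r : ℝ} (hr : 0 < r) :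
    ∃ η : Ω → E, Measurable η ∧ ∀ ω, dist (TopologicalSpace.denseSeq E i) (η ω) ≤ 4 * r ∧
      (IsClosed (X ω) → (X ω ∩ Metric.ball (TopologicalSpace.denseSeq E i) r).Nonempty →
        η ω ∈ X ω) := by
  set D := TopologicalSpace.denseSeq E
  choose next hnext hspec using fun (n : {n : Ω → ℕ // Measurable n}) (k : ℕ) =>
    exists_refined_index hX n.2 (show 0 < r / 2 ^ k by positivity)
  let s : ℕ → {n : Ω → ℕ // Measurable n} := fun k =>
    Nat.rec ⟨fun _ => i, measurable_const⟩ (fun k n => ⟨next n k, hnext n k⟩) k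
  have hs : ∀ k ω, dist (D ((s k).1 ω)) (D ((s (k + 1)).1 ω)) ≤ 4 * r / 2 / 2 ^ k := by
    intro k ω
    refine ((hspec (s k) k ω).1).trans (le_of_eq ?_)
    ring
  have hlim : ∀ ω, ∃ x, Tendsto (fun k => D ((s k).1 ω)) atTop (𝓝 x) := fun ω =>
    cauchySeq_tendsto_of_complete (cauchySeq_of_le_geometric_two (hs · ω))
  choose η hη using hlim
  have hDm : Measurable D := measurable_from_top
  refine ⟨η, measurable_of_tendsto_metrizable (f := fun k ω => D ((s k).1 ω))
    (fun k => hDm.comp (s k).2) (tendsto_pi_nhds.2 hη), fun ω => ⟨?_, fun hc hne => ?_⟩⟩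
  · exact dist_le_of_le_geometric_two_of_tendsto₀ (hs · ω) (hη ω)
  · have hit : ∀ k, (X ω ∩ Metric.ball (D ((s k).1 ω)) (r / 2 ^ k)).Nonempty := by
      intro k
      induction k with
      | zero =>
        show (X ω ∩ Metric.ball (D i) (r / 2 ^ 0)).Nonempty
        simpa using hne
      | succ k ih =>
        have := (hspec (s k) k ω).2 ih
        rwa [div_div, ← pow_succ] at this
    choose x hx hx' using hit
    refine hc.mem_of_tendsto (f := x) (b := atTop) ?_ (Eventually.of_forall hx)
    refine (hη ω).congr_dist ?_
    have h0 : Tendsto (fun k : ℕ => r / 2 ^ k) atTop (𝓝 0) :=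
      tendsto_const_nhds.div_atTop (tendsto_pow_atTop_atTop_of_one_lt one_lt_two)
    refine squeeze_zero (fun _ => dist_nonneg) (fun k => ?_) h0
    rw [dist_comm]
    exact (Metric.mem_ball.1 (hx' k)).le

/-- The hypothesis has a null set for each class `ζ`. Countably many measurable selections,
localized near every point of a dense sequence at every scale, are dense in `X ω` and reduce this to
one null set. -/
theorem ae_subset_closure_range [TopologicalSpace.SeparableSpace E] [CompleteSpace E]
    [MeasurableSpace E] [BorelSpace E] [IsFiniteMeasure P] {X : Ω → Set E}
    (hX : IsClosedRandomSet P X) (hne : (selections p P X).Nonempty) {ξ : ℕ → Lp E p P}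
    (hξ : ∀ ζ ∈ selections p P X, ∀ᵐ ω ∂P,
      (ζ : Ω → E) ω ∈ closure (range fun n => (ξ n : Ω → E) ω)) :
    ∀ᵐ ω ∂P, X ω ⊆ closure (range fun n => (ξ n : Ω → E) ω) := by
  have : SecondCountableTopology E := UniformSpace.secondCountable_of_separable E
  obtain ⟨ξ₀, hξ₀⟩ := hne
  set D := TopologicalSpace.denseSeq E
  have hr : ∀ j : ℕ, (0 : ℝ) < 1 / (j + 1) := fun j => by positivity
  choose η hηm hη using fun i j : ℕ => exists_measurable_selection_near hX.effros i (hr j)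
  have hmain : ∀ i j k : ℕ, ∀ᵐ ω ∂P, (X ω ∩ Metric.ball (D i) (1 / (j + 1))).Nonempty →
      ‖η i j ω‖ ≤ k → η i j ω ∈ closure (range fun n => (ξ n : Ω → E) ω) := by
    intro i j k
    -- A localized selection need not be integrable: it is used only where it is bounded by `k` and
    -- lies in `X`, and replaced by `ξ₀` elsewhere.
    set S : Set Ω := {ω | (X ω ∩ Metric.ball (D i) (1 / (j + 1))).Nonempty} ∩
      {ω | ‖η i j ω‖ ≤ k} with hSdef
    have hS : MeasurableSet S := (hX.effros _ Metric.isOpen_ball).inter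
      (measurableSet_le (hηm i j).norm measurable_const)
    have hm : MemLp (S.indicator (η i j)) p P := by
      refine MemLp.of_bound ((hηm i j).indicator hS).aestronglyMeasurable k
        (Eventually.of_forall fun ω => ?_)
      by_cases hω : ω ∈ S
      · rw [indicator_of_mem hω]
        exact hω.2
      · rw [indicator_of_notMem hω, norm_zero]
        positivity
    have hm' := hm.add ((Lp.memLp ξ₀).indicator hS.compl)
    have hsel : hm'.toLp ∈ selections p P X := by
      rw [mem_selections_iff hX.nonempty]
      filter_upwards [(mem_selections_iff hX.nonempty).1 hξ₀, hX.isClosed, hm'.coeFn_toLp]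
        with ω h1 h2 h3
      rw [h3, Pi.add_apply]
      by_cases hω : ω ∈ S
      · rw [indicator_of_mem hω, indicator_of_notMem (by simpa using hω), add_zero]
        exact (hη i j ω).2 h2 hω.1
      · rwa [indicator_of_notMem hω, indicator_of_mem (by simpa using hω), zero_add]
    filter_upwards [hξ _ hsel, hm'.coeFn_toLp] with ω h1 h2 h3 h4
    have hω : ω ∈ S := ⟨h3, h4⟩
    rwa [h2, Pi.add_apply, indicator_of_mem hω, indicator_of_notMem (by simpa using hω),
      add_zero] at h1
  filter_upwards [ae_all_iff.2 fun i => ae_all_iff.2 fun j => ae_all_iff.2 fun k => hmain i j k]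
    with ω hω x hx
  rw [← closure_closure, Metric.mem_closure_iff]
  intro ε hε
  -- The 5 is 1 for the distance from `x` to `D i` plus 4 for that from `D i` to the selection.
  obtain ⟨j, hj⟩ := exists_nat_one_div_lt (show 0 < ε / 5 by positivity)
  obtain ⟨i, hi⟩ := (TopologicalSpace.denseRange_denseSeq E).exists_dist_lt x (hr j)
  obtain ⟨k, hk⟩ := exists_nat_ge ‖η i j ω‖
  refine ⟨η i j ω, hω i j k ⟨x, hx, hi⟩ hk, ?_⟩
  have h1 := (hη i j ω).1
  have h2 := dist_triangle x (D i) (η i j ω)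
  linarith

variable [NormedSpace ℝ E]

/-- Rational weights keep the conditions countable, so that they can hold simultaneously almost
surely. -/
theorem convex_closure_of_rat_combo {S : Set E}
    (h : ∀ x ∈ S, ∀ y ∈ S, ∀ q : ℚ, (0 : ℝ) ≤ q → (q : ℝ) ≤ 1 →
      (q : ℝ) • x + (1 - (q : ℝ)) • y ∈ closure S) : Convex ℝ (closure S) := by
  have hq : ∀ x ∈ closure S, ∀ y ∈ closure S, ∀ q : ℚ, (0 : ℝ) ≤ q → (q : ℝ) ≤ 1 →
      (q : ℝ) • x + (1 - (q : ℝ)) • y ∈ closure S := by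
    intro x hx y hy q h0 h1
    have hc : Continuous fun z : E × E => (q : ℝ) • z.1 + (1 - (q : ℝ)) • z.2 := by fun_prop
    have := map_mem_closure (t := closure S) hc
      (show (x, y) ∈ closure (S ×ˢ S) by rw [closure_prod_eq]; exact ⟨hx, hy⟩)
      (fun z hz => h z.1 hz.1 z.2 hz.2 q h0 h1)
    rwa [closure_closure] at this
  intro x hx y hy a b ha hb hab
  -- Clamping to `[0, 1]` gives a closed condition on all of `ℝ`, which can be checked on the dense
  -- rationals.
  have hall : ∀ t : ℝ, max 0 (min 1 t) • x + (1 - max 0 (min 1 t)) • y ∈ closure S := by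
    intro t
    refine (Rat.denseRange_cast (𝕜 := ℝ)).induction_on
      (p := fun t => max 0 (min 1 t) • x + (1 - max 0 (min 1 t)) • y ∈ closure S) t ?_ ?_
    · exact isClosed_closure.preimage
        (f := fun t : ℝ => max 0 (min 1 t) • x + (1 - max 0 (min 1 t)) • y) (by fun_prop)
    · intro q
      have hcast : max 0 (min 1 (q : ℝ)) = ((max 0 (min 1 q) : ℚ) : ℝ) := by push_cast; rfl
      have h0 : (0 : ℝ) ≤ max 0 (min 1 (q : ℝ)) := le_max_left _ _
      have h1 : max 0 (min 1 (q : ℝ)) ≤ 1 := max_le zero_le_one (min_le_left _ _)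
      rw [hcast] at h0 h1 ⊢
      exact hq x hx y hy _ h0 h1
  have := hall a
  rw [min_eq_right (by linarith : a ≤ 1), max_eq_right ha] at this
  rwa [show b = 1 - a by linarith]

/-- A countable family `η` capturing the convex hull of the selections has a pointwise closure that
contains `X ω` and is convex, hence contains the closed convex hull of `X ω`; gluing then finishes.
-/
theorem selections_cconvPointwise [TopologicalSpace.SeparableSpace E] [CompleteSpace E]
    [MeasurableSpace E] [BorelSpace E] [IsProbabilityMeasure P] (hp : p = 0 ∨ 1 ≤ p)
    (hp' : p ≠ ∞) {X : Ω → Set E} (hX : IsClosedRandomSet P X)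
    (hne : (selections p P X).Nonempty) :
    selections p P (cconvPointwise X) = cconv (selections p P X) := by
  have hsub : selections p P X ⊆ convexHull ℝ (selections p P X) := subset_convexHull ℝ _
  have hdec := isDecomposable_convexHull (isDecomposable_selections (p := p) (P := P) X)
  obtain ⟨η, hη, hdense⟩ := exists_seq_ae_mem_closure (hne.mono hsub) hdec
  have hne' : ∀ᵐ ω ∂P, (cconvPointwise X ω).Nonempty :=
    hX.nonempty.mono fun ω hω => hω.convexHull.closure
  refine Subset.antisymm (fun Y hY => ?_) (clp_subset_selections ?_ ?_)
  · have hcomb : ∀ n m, ∀ q : ℚ, ∀ᵐ ω ∂P, (0 : ℝ) ≤ q → (q : ℝ) ≤ 1 →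
        (q : ℝ) • (η n : Ω → E) ω + (1 - (q : ℝ)) • (η m : Ω → E) ω ∈
          closure (range fun n => (η n : Ω → E) ω) := by
      intro n m q
      by_cases h : (0 : ℝ) ≤ q ∧ (q : ℝ) ≤ 1
      · have hmem := convex_convexHull ℝ (selections p P X) (hη n) (hη m) h.1
          (sub_nonneg.2 h.2) (add_sub_cancel _ _)
        filter_upwards [hdense _ hmem, Lp.coeFn_add ((q : ℝ) • η n) ((1 - (q : ℝ)) • η m),
          Lp.coeFn_smul (q : ℝ) (η n), Lp.coeFn_smul (1 - (q : ℝ)) (η m)] with ω h1 h2 h3 h4 _ _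
        rwa [h2, Pi.add_apply, h3, h4] at h1
      · exact Eventually.of_forall fun ω h0 h1 => absurd ⟨h0, h1⟩ h
    refine mem_clp_of_ae_mem_closure hp hp' hdec hη ?_
    filter_upwards [(mem_selections_iff hne').1 hY,
      ae_subset_closure_range hX hne (fun ζ hζ => hdense ζ (hsub hζ)),
      ae_all_iff.2 fun n => ae_all_iff.2 fun m => ae_all_iff.2 fun q => hcomb n m q]
      with ω h1 h2 h3
    refine closure_minimal (convexHull_min h2 (convex_closure_of_rat_combo ?_))
      isClosed_closure h1
    rintro _ ⟨n, rfl⟩ _ ⟨m, rfl⟩ q h0 h1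
    exact h3 n m q h0 h1
  · exact hne'.mono fun ω hω => ⟨hω, isClosed_closure⟩
  · refine convexHull_min (fun ξ hξ => ?_) ?_
    · rw [mem_selections_iff hne']
      exact ((mem_selections_iff hX.nonempty).1 hξ).mono fun ω hω =>
        subset_closure (subset_convexHull ℝ _ hω)
    · intro ξ hξ ζ hζ a b ha hb hab
      rw [mem_selections_iff hne'] at *
      filter_upwards [hξ, hζ, Lp.coeFn_add (a • ξ) (b • ζ), Lp.coeFn_smul a ξ, Lp.coeFn_smul b ζ]
        with ω h1 h2 h3 h4 h5
      rw [h3, Pi.add_apply, h4, h5]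
      exact (convex_convexHull ℝ (X ω)).closure h1 h2 ha hb hab

end Selection

end ChoquetDec

namespace ChoquetDec

/-! ### The Choquet decomposable hull is the closed decomposable hull. -/

section ChoquetDecomposable

variable {Ω : Type*} [MeasurableSpace Ω] {P : Measure Ω}
  {E : Type*} [NormedAddCommGroup E] [NormedSpace ℝ E] [TopologicalSpace.SeparableSpace E]
  [MeasurableSpace E] [BorelSpace E] {p : ℝ≥0∞}

theorem isChoquetDecomposable_of_isDecomposable {C : Set (Lp E p P)} (hC : IsDecomposable C)
    (hcl : clp C = C) : IsChoquetDecomposable C := by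
  intro F hF K hK hKF hKd Y hY
  rw [← hcl, ← hC.dec_eq, ← hF.2, mem_selections_iff hF.1.nonempty]
  classical
  let x : Ω → E := fun ω => if h : ∃ x, K ω = Measure.dirac x then h.choose else 0
  have hx : ∀ᵐ ω ∂P, K ω = Measure.dirac (x ω) := by
    filter_upwards [hKd] with ω hω
    simp only [x, dif_pos hω]
    exact hω.choose_spec
  -- The exceptional set depends on `L`; separability of `E` merges these into one null set.
  have hYx : (fun ω => (Y : Ω → E) ω - x ω) =ᵐ[P] 0 := by
    refine ae_eq_zero_of_forall_dual ℝ fun L => ?_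
    filter_upwards [hY L, hx] with ω h1 h2
    have h3 := h1.2
    rw [h2, integral_dirac] at h3
    simp [h3]
  filter_upwards [hYx, hx, hKF, hF.1.isClosed] with ω h1 h2 h3 h4
  have h5 : (Y : Ω → E) ω = x ω := sub_eq_zero.1 h1
  rw [h2, Measure.dirac_apply' _ h4.measurableSet] at h3
  rw [h5]
  by_contra h
  simp [indicator_of_notMem h] at h3

/-- Each selection `Y` of the representing set is the barycenter of the deterministic kernel at `Y`.
-/
theorem IsChoquetDecomposable.clp_dec_subset [IsProbabilityMeasure P] (hp : p = 0 ∨ 1 ≤ p)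
    (hp' : p ≠ ∞) {C : Set (Lp E p P)} (hC : IsChoquetDecomposable C) (hne : C.Nonempty) : clp (dec C) ⊆ C := by
  intro Y hYC
  obtain ⟨F, hF⟩ := exists_isRepresentingSet hp hp' hne
  rw [← hF.2, mem_selections_iff hF.1.nonempty] at hYC
  have hYm : Measurable (Y : Ω → E) := (Lp.stronglyMeasurable Y).measurable
  refine hC F hF (Kernel.deterministic Y hYm) inferInstance ?_ ?_ Y ?_
  · filter_upwards [hYC] with ω h1
    rw [Kernel.deterministic_apply]
    exact Measure.dirac_apply_of_mem h1
  · exact Eventually.of_forall fun ω => ⟨_, Kernel.deterministic_apply hYm ω⟩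
  · intro L
    refine Eventually.of_forall fun ω => ?_
    rw [Kernel.deterministic_apply, integral_dirac]
    exact ⟨integrable_dirac (by simp), rfl⟩

theorem chd_eq_clp_dec [IsProbabilityMeasure P] (hp : p = 0 ∨ 1 ≤ p) (hp' : p ≠ ∞)
    {A : Set (Lp E p P)} (hA : A.Nonempty) : chd A = clp (dec A) := by
  refine Subset.antisymm (fun Y hY => hY _ ⟨isChoquetDecomposable_of_isDecomposable
    (isDecomposable_clp hp (isDecomposable_dec A)) (clp_clp hp _),
    (subset_dec A).trans (subset_clp _)⟩) ?_
  rintro Y hY C ⟨hC, hAC⟩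
  exact hC.clp_dec_subset hp hp' (hA.mono hAC) (clp_mono (dec_mono hAC) hY)

end ChoquetDecomposable

/-! ### Choquet sets and convexity. -/

section Choquet

variable {V : Type*} [NormedAddCommGroup V] [NormedSpace ℝ V]

/-- A functional strictly separating `y` from `C` would have an integral at most `u`, yet exceed `u`
at the barycenter. -/
theorem isChoquet_of_isClosed {C : Set V} (hC : Convex ℝ C) (hcl : IsClosed C) : IsChoquet C := by
  borelize V
  rintro μ hμ - ⟨B, hBC, hB, hμB⟩ y hy
  by_contra hyC
  obtain ⟨L, u, hL, hu⟩ := geometric_hahn_banach_closed_point hC hcl hyC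
  obtain ⟨hint, hLy⟩ := hy L
  have hae : ∀ᵐ x ∂μ, x ∈ B := by
    rw [← prob_compl_eq_zero_iff hB] at hμB
    exact hμB
  have : ∫ x, L x ∂μ ≤ ∫ _, u ∂μ :=
    integral_mono_ae hint (integrable_const u) (hae.mono fun x hx => (hL x (hBC hx)).le)
  simp only [integral_const, probReal_univ, one_smul] at this
  linarith

theorem IsChoquet.convex {C : Set V} (hC : IsChoquet C) : Convex ℝ C := by
  borelize V
  intro x hx y hy a b ha hb hab
  set μ : Measure V := ENNReal.ofReal a • Measure.dirac x + ENNReal.ofReal b • Measure.dirac y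
    with hμ
  have hprob : IsProbabilityMeasure μ := ⟨by
    simp [hμ, ← ENNReal.ofReal_add ha hb, hab]⟩
  -- `V` need not be separable, so regularity of the two-point measure is obtained from compactness
  -- of singletons.
  have hdirac : ∀ z : V, (Measure.dirac z).InnerRegular := fun z =>
    ⟨fun U hU r hr => by
      rw [Measure.dirac_apply' _ hU] at hr
      by_cases hz : z ∈ U
      · refine ⟨{z}, singleton_subset_iff.2 hz, isCompact_singleton, ?_⟩
        rw [Measure.dirac_apply_of_mem (mem_singleton z)]
        simpa [hz] using hr
      · simp [hz] at hr⟩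
  have := hdirac x
  have := hdirac y
  have hreg : μ.Regular := inferInstance
  refine hC μ hprob hreg ⟨{x, y}, ?_, (Set.toFinite _).measurableSet, ?_⟩ _ fun L => ⟨?_, ?_⟩
  · rintro z (rfl | rfl) <;> assumption
  · simp [hμ, ← ENNReal.ofReal_add ha hb, hab]
  · exact ((integrable_dirac (by simp)).smul_measure ENNReal.ofReal_ne_top).add_measure
      ((integrable_dirac (by simp)).smul_measure ENNReal.ofReal_ne_top)
  · rw [hμ, integral_add_measure
      ((integrable_dirac (by simp)).smul_measure ENNReal.ofReal_ne_top)
      ((integrable_dirac (by simp)).smul_measure ENNReal.ofReal_ne_top),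
      integral_smul_measure, integral_smul_measure, integral_dirac, integral_dirac,
      ENNReal.toReal_ofReal ha, ENNReal.toReal_ofReal hb, map_add, map_smul, map_smul]

theorem convexHull_subset_choquetHull (A : Set V) : convexHull ℝ A ⊆ choquetHull A :=
  subset_sInter fun _ hC => convexHull_min hC.2 hC.1.convex

theorem choquetHull_subset_closure_convexHull (A : Set V) :
    choquetHull A ⊆ closure (convexHull ℝ A) :=
  sInter_subset_of_mem ⟨isChoquet_of_isClosed (convex_convexHull ℝ A).closure isClosed_closure,
    (subset_convexHull ℝ A).trans subset_closure⟩

end Choquet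

end ChoquetDec

/-! ### The theorem. -/

open ChoquetDec
theorem theorem6p9 {Ω : Type*} [MeasurableSpace Ω] (P : Measure Ω) [IsProbabilityMeasure P]
    [P.IsComplete] {E : Type*} [NormedAddCommGroup E] [NormedSpace ℝ E] [CompleteSpace E]
    [TopologicalSpace.SeparableSpace E] [MeasurableSpace E] [BorelSpace E]
    (p : ℝ≥0∞) (hp : p = 0 ∨ (1 ≤ p ∧ p ≠ ∞)) :
    (∀ [Fact (1 ≤ p)] (A : Set (Lp E p P)), A.Nonempty → Convex ℝ A → IsChoquet (chd A)) ∧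
    ∀ A : Set (Lp E p P), A.Nonempty →
      (∀ [Fact (1 ≤ p)], chd (choquetHull A) = chd (convexHull ℝ A)) ∧
      (∃ F : Ω → Set E, IsRepresentingSet A F) ∧
      ∀ F : Ω → Set E, IsRepresentingSet A F →
        chd (convexHull ℝ A) = selections p P (cconvPointwise F) ∧
        selections p P (cconvPointwise F) = cconv (selections p P F) ∧
        cconv (selections p P F) = cconv (chd A) ∧
        cconv (chd A) = clp (convexHull ℝ (dec A)) ∧
        clp (convexHull ℝ (dec A)) = clp (dec (convexHull ℝ A)) := by
  have hp1 : p = 0 ∨ 1 ≤ p := hp.imp_right And.left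
  have hp' : p ≠ ∞ := by
    rcases hp with rfl | h
    · exact ENNReal.zero_ne_top
    · exact h.2
  refine ⟨fun A hA hconv => ?_, fun A hA => ⟨?_, exists_isRepresentingSet hp1 hp' hA, ?_⟩⟩
  · rw [chd_eq_clp_dec hp1 hp' hA, clp_eq_closure]
    exact isChoquet_of_isClosed (convex_dec hconv).closure isClosed_closure
  · intro _
    have hconv := hA.mono (subset_convexHull ℝ A)
    have hch := convexHull_subset_choquetHull A
    rw [chd_eq_clp_dec hp1 hp' hconv, chd_eq_clp_dec hp1 hp' (hconv.mono hch)]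
    refine Subset.antisymm (clp_subset (clp_clp hp1 _) (dec_subset
      (isDecomposable_clp hp1 (isDecomposable_dec _)) ?_)) (clp_mono (dec_mono hch))
    refine (choquetHull_subset_closure_convexHull A).trans ?_
    rw [← clp_eq_closure]
    exact clp_mono (subset_dec _)
  · intro F hF
    have hne : (selections p P F).Nonempty :=
      hF.2 ▸ (hA.mono (subset_dec A)).mono (subset_clp _)
    have h2 := selections_cconvPointwise hp1 hp' hF.1 hne
    have h3 : cconv (selections p P F) = cconv (chd A) := by
      rw [hF.2, chd_eq_clp_dec hp1 hp' hA]
    have h4 : cconv (chd A) = clp (convexHull ℝ (dec A)) := by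
      rw [chd_eq_clp_dec hp1 hp' hA]
      exact Subset.antisymm (clp_subset (clp_clp hp1 _) (convexHull_min
        (clp_mono (subset_convexHull ℝ _)) (convex_clp hp1 (convex_convexHull ℝ _))))
        (clp_mono (convexHull_mono (subset_clp _)))
    have h5 : clp (convexHull ℝ (dec A)) = clp (dec (convexHull ℝ A)) := by
      rw [dec_convexHull]
    refine ⟨?_, h2, h3, h4, h5⟩
    rw [chd_eq_clp_dec hp1 hp' (hA.mono (subset_convexHull ℝ A)), h2, h3, h4, h5]
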